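/- Let $H\in(0,\tfrac12)$, let $X_0,a,\sigma>0$ be constants, and let $B^H=\{B^H_t,\,t\ge 0\}$ be a fractional Brownian motion with Hurst index $H$ on a probability space, i.e. a centred Gaussian process with a.s. continuous paths and covariance $\mathsf E B^H_tB^H_s=\tfrac12\left(t^{2H}+s^{2H}-|t-s|^{2H}\right)$. For $\varepsilon>0$ let $Y^\varepsilon$ be the continuous solution of $$Y^\varepsilon_t=X_0+a\int_0^t\frac{ds}{Y^\varepsilon_s\mathbf 1_{\{Y^\varepsilon_s>0\}}+\varepsilon}+\sigma B^H_t,\qquad t\ge0,$$ and let $X^H_t=\lim_{\varepsilon\downarrow0}Y^\varepsilon_t$ be the fractional diffusion Bessel process. This process is well defined: almost surely, $Y^\varepsilon$ exists and is unique for every $\varepsilon>0$, and the finite limit $X^H_t$ exists for every $t\ge0$. Moreover: (i) for every $\alpha\in(0,\tfrac12)$, with probability $1$, $\displaystyle\limsup_{t\to\infty}\frac{X^H_t}{t^\alpha}=+\infty$; (ii) with probability $1$, $\displaystyle\limsup_{t\to\infty}\frac{X^H_t}{\sqrt t}\ge\sqrt{2a}$. In particular, this holds for $\sigma=1$. -/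

import Mathlib

open MeasureTheory ProbabilityTheory Filter Topology
open scoped NNReal

namespace FracBessel

/-- `B` is a fractional Brownian motion with Hurst index `H` on `(Ω, P)`: a centred Gaussian
process indexed by `[0, ∞)`, with covariance `(t^{2H} + s^{2H} - |t - s|^{2H}) / 2` and almost
surely continuous paths. -/
structure IsFractionalBrownianMotion {Ω : Type*} [MeasurableSpace Ω] (H : ℝ)
    (B : ℝ≥0 → Ω → ℝ) (P : Measure Ω) : Prop where
  gaussian : IsGaussianProcess B P
  mean_eq_zero : ∀ t : ℝ≥0, ∫ ω, B t ω ∂P = 0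
  covariance_eq : ∀ s t : ℝ≥0, ∫ ω, B t ω * B s ω ∂P =
    ((t : ℝ) ^ (2 * H) + (s : ℝ) ^ (2 * H) - |(t : ℝ) - (s : ℝ)| ^ (2 * H)) / 2
  continuous_paths : ∀ᵐ ω ∂P, Continuous fun t : ℝ≥0 => B t ω

/-- The regularised drift `1 / (x 1_{x > 0} + ε)`. -/
noncomputable def regDrift (ε x : ℝ) : ℝ := 1 / ((if 0 < x then x else 0) + ε)

/-- The path `y` is a continuous solution on `[0, ∞)` of
`y_t = x₀ + a ∫₀ᵗ ds / (y_s 1_{y_s > 0} + ε) + σ b_t`, driven by the path `b`. -/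
def IsRegSolution (x₀ a σ ε : ℝ) (b y : ℝ≥0 → ℝ) : Prop :=
  Continuous y ∧
    ∀ t : ℝ≥0, y t = x₀ + a * (∫ s in (0 : ℝ)..(t : ℝ), regDrift ε (y s.toNNReal)) + σ * b t

/-- The solution `Y^ε` of the regularised equation driven by `b`
(an arbitrary path if there is no solution). -/
noncomputable def regSolution (x₀ a σ ε : ℝ) (b : ℝ≥0 → ℝ) : ℝ≥0 → ℝ :=
  Classical.epsilon fun y => IsRegSolution x₀ a σ ε b y

/-- The fractional diffusion Bessel process driven by `B`: the pointwise limit, as `ε ↓ 0`,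
of the solutions `Y^ε` of the regularised equations. -/
noncomputable def besselProcess {Ω : Type*} (x₀ a σ : ℝ) (B : ℝ≥0 → Ω → ℝ)
    (t : ℝ≥0) (ω : Ω) : ℝ :=
  limUnder (𝓝[>] (0 : ℝ)) fun ε => regSolution x₀ a σ ε (fun s => B s ω) t

end FracBessel

/-!
The argument is pathwise, for a continuous driving path `b`, except for a single property of
fractional Brownian motion.

*Well-posedness.* The regularised drift `regDrift ε x` is bounded and Lipschitz in `x`, so
Picard-Lindelöf gives solutions on every interval `[0, n]`. It decreases in both `x` and `ε`, and
this gives a comparison principle (`IsRegSolutionOn.le`): the difference of two solutions with the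
same `ε` cannot leave `0`, so the solution is unique, and solutions with smaller `ε` are larger.
Where the solution exceeds `1` the drift is at most `a` for every `ε`, so the solutions are bounded
uniformly in `ε` (`IsRegSolution.exists_le`), and their monotone limit `X`, as `ε ↓ 0`, is finite
and dominates each of them.

*Growth.* Suppose that `X t ≤ c √t` for all large `t`, where `c < q = √(2a)`. The solution `Y` with
`ε = 1` obeys the same bound, so its drift at time `s` is eventually at least `a / (q √s)`, and
`X t ≥ Y t ≥ (2a / q) √t + σ b t + K = q √t + σ b t + K` (`IsRegSolution.exists_mul_sqrt_le`).
Along times `t` with `b t / √t → 0` this contradicts the bound `X t ≤ c √t`. Such times exist almost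
surely, because `E (B t)² / t = t ^ (2H - 1) → 0` when `H < 1 / 2`. Growth of order `√t` along
arbitrarily large times also makes `X t / t ^ α` unbounded for every `α < 1 / 2`.
-/

namespace FracBessel

/-! ### The regularised drift -/

lemma regDrift_eq (ε x : ℝ) : regDrift ε x = 1 / (max x 0 + ε) := by
  unfold regDrift
  split_ifs with h
  · rw [max_eq_left h.le]
  · rw [max_eq_right (not_lt.1 h)]

lemma regDrift_nonneg {ε : ℝ} (hε : 0 < ε) (x : ℝ) : 0 ≤ regDrift ε x := by
  rw [regDrift_eq]; positivity

lemma regDrift_le {ε : ℝ} (hε : 0 < ε) (x : ℝ) : regDrift ε x ≤ 1 / ε := by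
  rw [regDrift_eq]
  exact one_div_le_one_div_of_le hε (le_add_of_nonneg_left (le_max_right _ _))

lemma continuous_regDrift {ε : ℝ} (hε : 0 < ε) : Continuous (regDrift ε) := by
  have : regDrift ε = fun x => 1 / (max x 0 + ε) := funext (regDrift_eq ε)
  rw [this]
  refine continuous_const.div (by fun_prop) fun x => ?_
  positivity

/-- The regularised drift decreases in the state and in the regularisation parameter. -/
lemma regDrift_le_regDrift {ε₁ ε₂ x₁ x₂ : ℝ} (hε₁ : 0 < ε₁) (hε : ε₁ ≤ ε₂) (hx : x₁ ≤ x₂) :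
    regDrift ε₂ x₂ ≤ regDrift ε₁ x₁ := by
  rw [regDrift_eq, regDrift_eq]
  gcongr

lemma lipschitzWith_regDrift {ε : ℝ} (hε : 0 < ε) :
    LipschitzWith (Real.toNNReal (1 / ε ^ 2)) (regDrift ε) := by
  refine LipschitzWith.of_dist_le_mul fun x y => ?_
  rw [Real.coe_toNNReal _ (by positivity), Real.dist_eq, Real.dist_eq, regDrift_eq, regDrift_eq]
  have hx : 0 < max x 0 + ε := by positivity
  have hy : 0 < max y 0 + ε := by positivity
  rw [div_sub_div _ _ hx.ne' hy.ne', abs_div, abs_of_pos (mul_pos hx hy), one_div_mul_eq_div]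
  have h1 : |1 * (max y 0 + ε) - (max x 0 + ε) * 1| ≤ |x - y| := by
    rw [one_mul, mul_one, add_sub_add_right_eq_sub, abs_sub_comm x y]
    exact abs_max_sub_max_le_abs y x 0
  have h2 : ε ^ 2 ≤ (max x 0 + ε) * (max y 0 + ε) := by
    rw [sq]
    exact mul_le_mul (le_add_of_nonneg_left (le_max_right _ _))
      (le_add_of_nonneg_left (le_max_right _ _)) hε.le hx.le
  gcongr

/-! ### Comparison, existence and uniqueness for the regularised equation -/

/-- The path `y` is continuous and solves the regularised equation up to time `T`. -/
def IsRegSolutionOn (T : ℝ≥0) (x₀ a σ ε : ℝ) (b y : ℝ≥0 → ℝ) : Prop :=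
  Continuous y ∧
    ∀ t ≤ T, y t = x₀ + a * (∫ s in (0 : ℝ)..(t : ℝ), regDrift ε (y s.toNNReal)) + σ * b t

section
variable {x₀ a σ ε ε₁ ε₂ : ℝ} {b y y₁ y₂ : ℝ≥0 → ℝ} {s t T : ℝ≥0}

lemma IsRegSolution.on (h : IsRegSolution x₀ a σ ε b y) (T : ℝ≥0) :
    IsRegSolutionOn T x₀ a σ ε b y :=
  ⟨h.1, fun t _ => h.2 t⟩

lemma continuous_regDrift_comp (hε : 0 < ε) (hy : Continuous y) :
    Continuous fun s : ℝ => regDrift ε (y s.toNNReal) :=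
  (continuous_regDrift hε).comp (hy.comp continuous_real_toNNReal)

lemma IsRegSolutionOn.sub_eq (h : IsRegSolutionOn T x₀ a σ ε b y) (hε : 0 < ε)
    (hst : s ≤ t) (htT : t ≤ T) :
    y t - y s = a * (∫ u in (s : ℝ)..(t : ℝ), regDrift ε (y u.toNNReal)) + σ * (b t - b s) := by
  have hc := continuous_regDrift_comp hε h.1
  rw [h.2 t htT, h.2 s (hst.trans htT), ← intervalIntegral.integral_interval_sub_left
    (hc.intervalIntegrable 0 t) (hc.intervalIntegrable 0 s)]
  ring

/-- A continuous path that starts nonnegative and is negative at time `t` has a last time before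
`t` at which it is nonnegative. -/
lemma exists_last_nonneg {f : ℝ≥0 → ℝ} (hf : Continuous f) (h0 : 0 ≤ f 0) (t : ℝ≥0) :
    ∃ s ≤ t, 0 ≤ f s ∧ ∀ u, s < u → u ≤ t → f u < 0 := by
  have hK : IsCompact (Set.Icc 0 t ∩ {u | 0 ≤ f u}) :=
    isCompact_Icc.inter_right (isClosed_le continuous_const hf)
  obtain ⟨s, hs, hmax⟩ := hK.exists_isGreatest ⟨0, ⟨le_rfl, zero_le⟩, h0⟩
  refine ⟨s, hs.1.2, hs.2, fun u hsu hut => ?_⟩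
  by_contra! hu
  exact hsu.not_ge (hmax ⟨⟨zero_le, hut⟩, hu⟩)

/-- Comparison principle. After the last time before `t` at which `y₂ ≤ y₁`, the drift of `y₁`
would dominate that of `y₂`, so that `y₁ - y₂` could only increase. With `ε₁ = ε₂` this gives
uniqueness. -/
lemma IsRegSolutionOn.le (ha : 0 ≤ a) (hε₁ : 0 < ε₁) (hε : ε₁ ≤ ε₂)
    (h₁ : IsRegSolutionOn T x₀ a σ ε₁ b y₁) (h₂ : IsRegSolutionOn T x₀ a σ ε₂ b y₂)
    (htT : t ≤ T) : y₂ t ≤ y₁ t := by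
  have h0 : y₁ 0 - y₂ 0 = 0 := by
    rw [h₁.2 0 (zero_le), h₂.2 0 (zero_le)]
    simp
  obtain ⟨s, hst, hs, hlast⟩ := exists_last_nonneg (h₁.1.sub h₂.1) h0.ge t
  have e₁ := h₁.sub_eq hε₁ hst htT
  have e₂ := h₂.sub_eq (hε₁.trans_le hε) hst htT
  have hint : (∫ u in (s : ℝ)..(t : ℝ), regDrift ε₂ (y₂ u.toNNReal)) ≤
      ∫ u in (s : ℝ)..(t : ℝ), regDrift ε₁ (y₁ u.toNNReal) := by
    refine intervalIntegral.integral_mono_on_of_le_Ioo (NNReal.coe_le_coe.2 hst)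
      ((continuous_regDrift_comp (hε₁.trans_le hε) h₂.1).intervalIntegrable _ _)
      ((continuous_regDrift_comp hε₁ h₁.1).intervalIntegrable _ _) fun u hu => ?_
    refine regDrift_le_regDrift hε₁ hε (sub_neg.1 (hlast _ ?_ ?_)).le
    · exact (Real.lt_toNNReal_iff_coe_lt).2 hu.1
    · exact Real.toNNReal_le_iff_le_coe.2 hu.2.le
  have := mul_le_mul_of_nonneg_left hint ha
  simp only [Pi.sub_apply] at hs
  linarith

lemma IsRegSolutionOn.eq (ha : 0 ≤ a) (hε : 0 < ε) (h₁ : IsRegSolutionOn T x₀ a σ ε b y₁)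
    (h₂ : IsRegSolutionOn T x₀ a σ ε b y₂) (htT : t ≤ T) : y₁ t = y₂ t :=
  le_antisymm (h₂.le ha hε le_rfl h₁ htT) (h₁.le ha hε le_rfl h₂ htT)

/-- Picard-Lindelöf for `z = y - σ b`, whose equation `z' = a regDrift ε (z + σ b)` has a bounded
vector field that is Lipschitz in the state. -/
lemma exists_isRegSolutionOn (ha : 0 ≤ a) (hε : 0 < ε) (hb : Continuous b) (x₀ σ : ℝ) (T : ℝ≥0) :
    ∃ y, IsRegSolutionOn T x₀ a σ ε b y := by
  let v : ℝ → ℝ → ℝ := fun t x => a * regDrift ε (x + σ * b t.toNNReal)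
  let t₀ : Set.Icc (0 : ℝ) T := ⟨0, le_rfl, T.2⟩
  have hbc : Continuous fun t : ℝ => b t.toNNReal := hb.comp continuous_real_toNNReal
  -- The vector field is bounded by `a / ε`, so on `[0, T]` solutions stay within `(a / ε) T` of `x₀`.
  have hv : IsPicardLindelof v t₀ x₀ ((a / ε).toNNReal * T) 0 (a / ε).toNNReal
      (a.toNNReal * (1 / ε ^ 2).toNNReal) := by
    refine ⟨fun t _ => LipschitzWith.lipschitzOnWith ?_, fun x _ => ?_, fun t _ x _ => ?_, ?_⟩
    · refine LipschitzWith.of_dist_le_mul fun x y => ?_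
      have := (lipschitzWith_regDrift hε).dist_le_mul (x + σ * b t.toNNReal) (y + σ * b t.toNNReal)
      rw [dist_add_right] at this
      simp only [v]
      rw [Real.dist_eq, ← mul_sub, abs_mul, abs_of_nonneg ha, ← Real.dist_eq, NNReal.coe_mul,
        Real.coe_toNNReal _ ha, mul_assoc]
      exact mul_le_mul_of_nonneg_left this ha
    · exact (continuous_const.mul ((continuous_regDrift hε).comp
        (continuous_const.add (continuous_const.mul hbc)))).continuousOn
    · rw [Real.norm_of_nonneg (mul_nonneg ha (regDrift_nonneg hε _)),
        Real.coe_toNNReal _ (by positivity)]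
      calc a * regDrift ε (x + σ * b t.toNNReal) ≤ a * (1 / ε) :=
            mul_le_mul_of_nonneg_left (regDrift_le hε _) ha
        _ = a / ε := by ring
    · simp [t₀]
  have hx : x₀ ∈ Metric.closedBall x₀ ((0 : ℝ≥0) : ℝ) := by simp
  obtain ⟨α, hα⟩ := ODE.FunSpace.exists_isFixedPt_next hv hx
  rw [ODE.FunSpace.isFixedPt_next_iff] at hα
  refine ⟨fun t => α.compProj t + σ * b t, ?_, fun t ht => ?_⟩
  · exact (α.continuous_compProj.comp NNReal.continuous_coe).add (continuous_const.mul hb)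
  · have h := hα ⟨t, t.2, ht⟩
    rw [ODE.picard_apply] at h
    have hc : α.compProj t = α ⟨t, t.2, ht⟩ := ODE.FunSpace.compProj_of_mem (α := α) ⟨t.2, ht⟩
    simp only [hc, h, v, t₀]
    rw [intervalIntegral.integral_const_mul]
    congr 3
    refine intervalIntegral.integral_congr fun u hu => ?_
    rw [Set.uIcc_of_le t.coe_nonneg] at hu
    simp only [Real.coe_toNNReal _ hu.1]

/-- Solutions on the intervals `[0, n]` agree where they overlap and glue to a global one. -/
lemma existsUnique_isRegSolution (ha : 0 ≤ a) (hε : 0 < ε) (hb : Continuous b) (x₀ σ : ℝ) :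
    ∃! y, IsRegSolution x₀ a σ ε b y := by
  choose y hy using fun n : ℕ => exists_isRegSolutionOn ha hε hb x₀ σ (n : ℝ≥0)
  have hloc : ∀ n : ℕ, ∀ t : ℝ≥0, t ≤ n → y (⌈t⌉₊) t = y n t := fun n t ht =>
    (hy _).eq ha hε (T := ⌈t⌉₊)
      ⟨(hy n).1, fun s hs => (hy n).2 s (hs.trans (Nat.cast_le.2 (Nat.ceil_le.2 ht)))⟩
      (Nat.le_ceil t)
  refine ⟨fun t => y ⌈t⌉₊ t, ⟨?_, fun t => ?_⟩, fun z hz => funext fun t => ?_⟩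
  · refine continuous_iff_continuousAt.2 fun t => ?_
    refine (hy (⌈t⌉₊ + 1)).1.continuousAt.congr ?_
    have : t < ((⌈t⌉₊ + 1 : ℕ) : ℝ≥0) := by
      push_cast
      exact (Nat.le_ceil t).trans_lt (lt_add_one _)
    filter_upwards [Iio_mem_nhds this] with s hs using (hloc _ s hs.le).symm
  · simp only
    rw [(hy ⌈t⌉₊).2 t (Nat.le_ceil t)]
    congr 3
    refine intervalIntegral.integral_congr fun u hu => ?_
    rw [Set.uIcc_of_le t.coe_nonneg] at hu
    rw [hloc ⌈t⌉₊ _ ((Real.toNNReal_le_iff_le_coe.2 hu.2).trans (Nat.le_ceil t))]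
  · exact (hz.on _).eq ha hε (hy ⌈t⌉₊) (Nat.le_ceil t)

/-! ### The limit as `ε ↓ 0` -/

/-- The bound is uniform in `ε`: since the last time `s ≤ t` at which `y s ≤ c`, the drift has been
at most `a`, as `c ≥ 1`. -/
lemma IsRegSolution.exists_le (ha : 0 ≤ a) (hb : Continuous b) (x₀ σ : ℝ) (t : ℝ≥0) :
    ∃ C, ∀ ε > 0, ∀ y, IsRegSolution x₀ a σ ε b y → y t ≤ C := by
  obtain ⟨M, hM⟩ := (isCompact_Icc (a := (0 : ℝ≥0)) (b := t)).exists_bound_of_continuousOn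
    (continuous_const.mul hb : Continuous fun u => σ * b u).continuousOn
  set c := max 1 (x₀ + σ * b 0)
  refine ⟨c + a * t + 2 * M, fun ε hε y hy => ?_⟩
  have h0 : 0 ≤ c - y 0 := by
    rw [hy.2 0]
    simp [c]
  obtain ⟨s, hst, hs, hlast⟩ := exists_last_nonneg (continuous_const.sub hy.1) h0 t
  have e := (hy.on t).sub_eq hε hst le_rfl
  have hint : (∫ u in (s : ℝ)..(t : ℝ), regDrift ε (y u.toNNReal)) ≤ ∫ u in (s : ℝ)..(t : ℝ), 1 := by
    refine intervalIntegral.integral_mono_on_of_le_Ioo (NNReal.coe_le_coe.2 hst)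
      ((continuous_regDrift_comp hε hy.1).intervalIntegrable _ _)
      (continuous_const.intervalIntegrable _ _) fun u hu => ?_
    have h := hlast u.toNNReal ((Real.lt_toNNReal_iff_coe_lt).2 hu.1)
      (Real.toNNReal_le_iff_le_coe.2 hu.2.le)
    have h1 : 1 ≤ y u.toNNReal := (le_max_left _ _).trans (sub_neg.1 h).le
    rw [regDrift_eq]
    refine (div_le_one (by positivity)).2 ?_
    linarith [le_max_left (y u.toNNReal) 0]
  rw [intervalIntegral.integral_const, smul_eq_mul, mul_one] at hint
  have h2 := mul_le_mul_of_nonneg_left (hint.trans (sub_le_self _ s.2)) ha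
  have h3 := abs_le.1 (hM s ⟨zero_le, hst⟩)
  have h4 := abs_le.1 (hM t ⟨zero_le, le_rfl⟩)
  rw [mul_sub] at e
  simp only [Pi.sub_apply, Pi.mul_apply] at hs h3 h4
  linarith

end

section
variable {x₀ a σ ε ε₁ ε₂ : ℝ} {b y : ℝ≥0 → ℝ} {t : ℝ≥0}

lemma isRegSolution_regSolution (ha : 0 ≤ a) (hε : 0 < ε) (hb : Continuous b) (x₀ σ : ℝ) :
    IsRegSolution x₀ a σ ε b (regSolution x₀ a σ ε b) :=
  Classical.epsilon_spec (existsUnique_isRegSolution ha hε hb x₀ σ).exists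

lemma regSolution_le (ha : 0 ≤ a) (hb : Continuous b) (hε₁ : 0 < ε₁) (hε : ε₁ ≤ ε₂) (t : ℝ≥0) :
    regSolution x₀ a σ ε₂ b t ≤ regSolution x₀ a σ ε₁ b t :=
  ((isRegSolution_regSolution ha hε₁ hb x₀ σ).on t).le ha hε₁ hε
    ((isRegSolution_regSolution ha (hε₁.trans_le hε) hb x₀ σ).on t) le_rfl

/-- The solutions increase as `ε` decreases to `0` and are bounded uniformly in `ε`. -/
lemma exists_tendsto_regSolution (ha : 0 ≤ a) (hb : Continuous b) (x₀ σ : ℝ) (t : ℝ≥0) :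
    ∃ l, Tendsto (fun ε => regSolution x₀ a σ ε b t) (𝓝[>] (0 : ℝ)) (𝓝 l) := by
  obtain ⟨C, hC⟩ := IsRegSolution.exists_le ha hb x₀ σ t
  refine ⟨_, AntitoneOn.tendsto_nhdsGT (fun ε₁ h₁ ε₂ _ h => regSolution_le ha hb h₁ h t)
    ⟨C, ?_⟩⟩
  rintro _ ⟨ε, hε, rfl⟩
  exact hC ε hε _ (isRegSolution_regSolution ha hε hb x₀ σ)

end

section
variable {Ω : Type*} {x₀ a σ ε : ℝ} {B : ℝ≥0 → Ω → ℝ} {ω : Ω}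

lemma tendsto_besselProcess (ha : 0 ≤ a) (hB : Continuous fun t => B t ω) (t : ℝ≥0) :
    Tendsto (fun ε => regSolution x₀ a σ ε (fun s => B s ω) t) (𝓝[>] (0 : ℝ))
      (𝓝 (besselProcess x₀ a σ B t ω)) :=
  tendsto_nhds_limUnder (exists_tendsto_regSolution ha hB x₀ σ t)

lemma regSolution_le_besselProcess (ha : 0 ≤ a) (hB : Continuous fun t => B t ω) (hε : 0 < ε)
    (t : ℝ≥0) :
    regSolution x₀ a σ ε (fun s => B s ω) t ≤ besselProcess x₀ a σ B t ω := by
  refine ge_of_tendsto (tendsto_besselProcess ha hB t) ?_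
  filter_upwards [Ioo_mem_nhdsGT hε] with δ hδ using regSolution_le ha hB hδ.1 hδ.2.le t

end

/-! ### Growth along a sequence of times -/

/-- If `y s ≤ c √s` for large `s`, then for any `q > c` the drift at `s` is eventually at least
`a / (q √s)`, whose integral is `(2 a / q) √t` up to a constant. -/
lemma IsRegSolution.exists_mul_sqrt_le {x₀ a σ ε c q : ℝ} {b y : ℝ≥0 → ℝ} (ha : 0 ≤ a) (hε : 0 < ε)
    (hy : IsRegSolution x₀ a σ ε b y) (hc : 0 ≤ c) (hcq : c < q)
    (hyc : ∀ᶠ s : ℝ≥0 in atTop, y s ≤ c * √s) :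
    ∃ K, ∀ᶠ t : ℝ≥0 in atTop, 2 * a / q * √t + σ * b t + K ≤ y t := by
  have hsqrt : Tendsto (fun s : ℝ≥0 => √(s : ℝ)) atTop atTop :=
    Real.tendsto_sqrt_atTop.comp (NNReal.tendsto_coe_atTop.2 tendsto_id)
  have hq : 0 < q := hc.trans_lt hcq
  -- The bound `√s ≥ ε / (q - c)` says that `c √s + ε ≤ q √s`.
  obtain ⟨T, hT⟩ := eventually_atTop.1 ((hyc.and (hsqrt.eventually_ge_atTop (ε / (q - c)))).and
    (eventually_gt_atTop 0))
  refine ⟨y T - σ * b T - 2 * a / q * √T, ?_⟩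
  filter_upwards [eventually_ge_atTop T] with t ht
  have hT0 : (0 : ℝ) < T := NNReal.coe_pos.2 (hT T le_rfl).2
  have hpos : ∀ u ∈ Set.uIcc (T : ℝ) t, 0 < u := fun u hu => by
    rw [Set.uIcc_of_le (NNReal.coe_le_coe.2 ht)] at hu
    exact hT0.trans_le hu.1
  have hcont : ContinuousOn (fun u : ℝ => 2 / q * (1 / (2 * √u))) (Set.uIcc (T : ℝ) t) := by
    refine continuousOn_const.mul (continuousOn_const.div (by fun_prop) fun u hu => ?_)
    have := Real.sqrt_pos.2 (hpos u hu)
    positivity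
  have hFTC : (∫ u in (T : ℝ)..t, 2 / q * (1 / (2 * √u))) = 2 / q * √t - 2 / q * √T :=
    intervalIntegral.integral_eq_sub_of_hasDerivAt
      (fun u hu => (Real.hasDerivAt_sqrt (hpos u hu).ne').const_mul _) hcont.intervalIntegrable
  have hint : (∫ u in (T : ℝ)..t, 2 / q * (1 / (2 * √u))) ≤
      ∫ u in (T : ℝ)..t, regDrift ε (y u.toNNReal) := by
    refine intervalIntegral.integral_mono_on (NNReal.coe_le_coe.2 ht) hcont.intervalIntegrable
      ((continuous_regDrift_comp hε hy.1).intervalIntegrable _ _) fun u hu => ?_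
    have hu0 : 0 < u := hT0.trans_le hu.1
    have hu' := hT u.toNNReal (NNReal.le_toNNReal_of_coe_le hu.1)
    rw [Real.coe_toNNReal _ hu0.le] at hu'
    have hsu := Real.sqrt_pos.2 hu0
    have h1 : max (y u.toNNReal) 0 ≤ c * √u := max_le hu'.1.1 (by positivity)
    have h2 : ε ≤ √u * (q - c) := (div_le_iff₀ (sub_pos.2 hcq)).1 hu'.1.2
    calc 2 / q * (1 / (2 * √u)) = 1 / (q * √u) := by field_simp
      _ ≤ regDrift ε (y u.toNNReal) := by
        rw [regDrift_eq]
        refine one_div_le_one_div_of_le (by positivity) ?_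
        linarith
  have e := (hy.on t).sub_eq hε ht le_rfl
  have h3 := mul_le_mul_of_nonneg_left hint ha
  rw [hFTC, mul_sub, ← mul_assoc, ← mul_assoc, ← mul_div_assoc, mul_comm a 2] at h3
  rw [mul_sub] at e
  linarith

/-- If `b / √t → 0` along some sequence of times tending to infinity and `x` dominates a regularised
solution, then `x` cannot stay below `c √t` with `c < √(2a)`: its drift would produce growth at
least `(2a / √(2a)) √t = √(2a) √t` along the sequence. -/
lemma sqrt_le_limsup_div_sqrt {x₀ a σ ε : ℝ} {b x y : ℝ≥0 → ℝ} (ha : 0 < a) (hε : 0 < ε)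
    (hy : IsRegSolution x₀ a σ ε b y) (hyx : ∀ t, y t ≤ x t) {τ : ℕ → ℝ≥0}
    (hτ : Tendsto τ atTop atTop) (hb : Tendsto (fun n => b (τ n) / √(τ n)) atTop (𝓝 0)) :
    ((√(2 * a) : ℝ) : EReal) ≤ limsup (fun t : ℝ≥0 => ((x t / √t : ℝ) : EReal)) atTop := by
  by_contra! hlt
  have hq : 0 < √(2 * a) := by positivity
  obtain ⟨c, hc1, hc2⟩ := EReal.lt_iff_exists_real_btwn.1
    (max_lt hlt (EReal.coe_lt_coe_iff.2 hq : ((0 : ℝ) : EReal) < _))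
  have hc0 : 0 < c := EReal.coe_lt_coe_iff.1 ((le_max_right _ _).trans_lt hc1)
  have hcq : c < √(2 * a) := EReal.coe_lt_coe_iff.1 hc2
  have hxc : ∀ᶠ t : ℝ≥0 in atTop, x t ≤ c * √t := by
    filter_upwards [eventually_lt_of_limsup_lt ((le_max_left _ _).trans_lt hc1),
      eventually_gt_atTop 0] with t ht ht0
    have : 0 < √(t : ℝ) := Real.sqrt_pos.2 (NNReal.coe_pos.2 ht0)
    exact ((div_lt_iff₀ this).1 (EReal.coe_lt_coe_iff.1 ht)).le
  obtain ⟨K, hK⟩ := hy.exists_mul_sqrt_le ha.le hε hc0.le hcq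
    (hxc.mono fun t ht => (hyx t).trans ht)
  have hsq : 2 * a / √(2 * a) = √(2 * a) := Real.div_sqrt
  rw [hsq] at hK
  have hsqrt : Tendsto (fun n => √(τ n : ℝ)) atTop atTop :=
    Real.tendsto_sqrt_atTop.comp (NNReal.tendsto_coe_atTop.2 hτ)
  have hlim : Tendsto (fun n => √(2 * a) + σ * (b (τ n) / √(τ n)) + K / √(τ n)) atTop
      (𝓝 (√(2 * a))) := by
    simpa using (tendsto_const_nhds.add (hb.const_mul σ)).add (hsqrt.const_div_atTop K)
  refine hcq.not_ge (le_of_tendsto hlim ?_)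
  filter_upwards [hτ.eventually hK, hτ.eventually hxc, hsqrt.eventually_gt_atTop 0]
    with n h1 h2 hpos
  rw [← mul_div_assoc, ← sub_nonneg]
  have : c - (√(2 * a) + σ * b (τ n) / √(τ n) + K / √(τ n)) =
      (c * √(τ n) - (√(2 * a) * √(τ n) + σ * b (τ n) + K)) / √(τ n) := by
    field_simp
  rw [this]
  have := hyx (τ n)
  exact div_nonneg (by linarith) hpos.le

/-- Growth of order `√t` along some times is faster than `t ^ α` for `α < 1 / 2`. -/
lemma limsup_div_rpow_eq_top {x : ℝ≥0 → ℝ} {q α : ℝ} (hq : 0 < q) (hα : α < 1 / 2)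
    (h : (q : EReal) ≤ limsup (fun t : ℝ≥0 => ((x t / √t : ℝ) : EReal)) atTop) :
    limsup (fun t : ℝ≥0 => ((x t / (t : ℝ) ^ α : ℝ) : EReal)) atTop = ⊤ := by
  refine (EReal.eq_top_iff_forall_lt _).2 fun M => ?_
  have hpow : Tendsto (fun t : ℝ≥0 => (t : ℝ) ^ (1 / 2 - α)) atTop atTop :=
    (tendsto_rpow_atTop (sub_pos.2 hα)).comp (NNReal.tendsto_coe_atTop.2 tendsto_id)
  have hfreq := frequently_lt_of_lt_limsup (b := ((q / 2 : ℝ) : EReal)) (by isBoundedDefault)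
    ((EReal.coe_lt_coe_iff.2 (half_lt_self hq)).trans_le h)
  refine (EReal.coe_lt_coe_iff.2 (lt_add_one M)).trans_le
    (le_limsup_of_frequently_le' ((hfreq.and_eventually
    ((hpow.eventually_ge_atTop ((M + 1) / (q / 2))).and (eventually_gt_atTop 0))).mono ?_))
  rintro t ⟨h1, h2, ht⟩
  have ht0 : (0 : ℝ) < t := NNReal.coe_pos.2 ht
  refine EReal.coe_le_coe_iff.2 ?_
  have e : x t / (t : ℝ) ^ α = x t / √t * (t : ℝ) ^ (1 / 2 - α) := by
    rw [Real.rpow_sub ht0, Real.sqrt_eq_rpow]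
    field_simp
  rw [e]
  calc M + 1 ≤ (t : ℝ) ^ (1 / 2 - α) * (q / 2) := (div_le_iff₀ (by positivity)).1 h2
    _ = q / 2 * (t : ℝ) ^ (1 / 2 - α) := mul_comm _ _
    _ ≤ _ := mul_le_mul_of_nonneg_right (EReal.coe_lt_coe_iff.1 h1).le (by positivity)

/-! ### Fractional Brownian motion along a sequence of times -/

/-- As `E (B n)² / n = n ^ (2H - 1) → 0`, the squares `(B n)² / n` tend to `0` in `L¹`, hence almost
surely along a subsequence. -/
lemma IsFractionalBrownianMotion.exists_seq_tendsto_div_sqrt {Ω : Type*} [MeasurableSpace Ω]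
    {H : ℝ} {B : ℝ≥0 → Ω → ℝ} {P : Measure Ω} (hB : IsFractionalBrownianMotion H B P)
    (hH0 : 0 < H) (hH : H < 1 / 2) :
    ∃ τ : ℕ → ℝ≥0, Tendsto τ atTop atTop ∧
      ∀ᵐ ω ∂P, Tendsto (fun n => B (τ n) ω / √(τ n)) atTop (𝓝 0) := by
  have hmem : ∀ t, MemLp (B t) 2 P := fun t => (hB.gaussian.hasGaussianLaw_eval t).memLp_two
  have hint : ∀ t : ℝ≥0, Integrable (fun ω => B t ω ^ 2 / t) P := fun t =>
    (hmem t).integrable_sq.div_const _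
  have hval : ∀ t : ℝ≥0, 0 < t → ∫ ω, B t ω ^ 2 / t ∂P = (t : ℝ) ^ (-(1 - 2 * H)) := by
    intro t ht
    have ht0 : (0 : ℝ) < t := NNReal.coe_pos.2 ht
    have h := hB.covariance_eq t t
    rw [sub_self, abs_zero, Real.zero_rpow (by positivity), sub_zero, add_self_div_two] at h
    simp_rw [integral_div, sq]
    rw [h, neg_sub, Real.rpow_sub ht0, Real.rpow_one]
  have hlim : Tendsto (fun n : ℕ => eLpNorm ((fun ω => B n ω ^ 2 / n) - fun _ => (0 : ℝ)) 1 P) atTop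
      (𝓝 0) := by
    have h1 : Tendsto (fun n : ℕ => ENNReal.ofReal ((n : ℝ) ^ (-(1 - 2 * H)))) atTop (𝓝 0) := by
      rw [← ENNReal.ofReal_zero]
      exact (ENNReal.continuous_ofReal.tendsto 0).comp
        ((tendsto_rpow_neg_atTop (by linarith)).comp tendsto_natCast_atTop_atTop)
    refine h1.congr' ?_
    filter_upwards [eventually_gt_atTop 0] with n hn
    have h2 := hval n (by exact_mod_cast hn)
    have h3 := hint n
    rw [NNReal.coe_natCast] at h2 h3
    rw [← h2, eLpNorm_one_eq_lintegral_enorm,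
      ofReal_integral_eq_lintegral_ofReal h3 (ae_of_all _ fun ω => by positivity)]
    refine lintegral_congr fun ω => ?_
    simp only [Pi.sub_apply, sub_zero]
    rw [Real.enorm_eq_ofReal (by positivity)]
  obtain ⟨ns, hns, hae⟩ := (tendstoInMeasure_of_tendsto_eLpNorm one_ne_zero
    (fun n : ℕ => (by simpa using (hint n).aestronglyMeasurable))
    aestronglyMeasurable_const hlim).exists_seq_tendsto_ae
  refine ⟨fun i => ns i, tendsto_natCast_atTop_atTop.comp hns.tendsto_atTop, ?_⟩
  filter_upwards [hae] with ω hω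
  rw [tendsto_zero_iff_abs_tendsto_zero]
  have := (Real.continuous_sqrt.tendsto 0).comp hω
  rw [Real.sqrt_zero] at this
  refine this.congr fun i => ?_
  simp only [Function.comp_apply, NNReal.coe_natCast]
  rw [Real.sqrt_div (sq_nonneg _), Real.sqrt_sq_eq_abs, abs_div, abs_of_nonneg (Real.sqrt_nonneg _)]

end FracBessel

open FracBessel

theorem mainTheorem2 {Ω : Type*} [MeasurableSpace Ω] (P : Measure Ω) [IsProbabilityMeasure P]
    (H : ℝ) (hH0 : 0 < H) (hH : H < 1 / 2)
    (x₀ a σ : ℝ) (hx₀ : 0 < x₀) (ha : 0 < a) (hσ : 0 < σ)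
    (B : ℝ≥0 → Ω → ℝ) (hB : FracBessel.IsFractionalBrownianMotion H B P) :
    -- the process is well defined
    (∀ᵐ ω ∂P,
      (∀ ε : ℝ, 0 < ε → ∃! y : ℝ≥0 → ℝ,
        FracBessel.IsRegSolution x₀ a σ ε (fun s => B s ω) y) ∧
      ∀ t : ℝ≥0, Tendsto (fun ε => FracBessel.regSolution x₀ a σ ε (fun s => B s ω) t)
        (𝓝[>] (0 : ℝ)) (𝓝 (FracBessel.besselProcess x₀ a σ B t ω))) ∧
    -- (i)
    (∀ α : ℝ, 0 < α → α < 1 / 2 → ∀ᵐ ω ∂P,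
      limsup (fun t : ℝ≥0 =>
        ((FracBessel.besselProcess x₀ a σ B t ω / (t : ℝ) ^ α : ℝ) : EReal)) atTop = ⊤) ∧
    -- (ii)
    (∀ᵐ ω ∂P,
      ((Real.sqrt (2 * a) : ℝ) : EReal) ≤
        limsup (fun t : ℝ≥0 =>
          ((FracBessel.besselProcess x₀ a σ B t ω / Real.sqrt (t : ℝ) : ℝ) : EReal)) atTop) := by
  obtain ⟨τ, hτ, hae⟩ := hB.exists_seq_tendsto_div_sqrt hH0 hH
  have hsup : ∀ᵐ ω ∂P, ((√(2 * a) : ℝ) : EReal) ≤ limsup (fun t : ℝ≥0 =>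
      ((besselProcess x₀ a σ B t ω / √(t : ℝ) : ℝ) : EReal)) atTop := by
    filter_upwards [hae, hB.continuous_paths] with ω hω hc
    exact sqrt_le_limsup_div_sqrt ha one_pos (isRegSolution_regSolution ha.le one_pos hc x₀ σ)
      (regSolution_le_besselProcess ha.le hc one_pos) hτ hω
  refine ⟨?_, fun α _ hα => ?_, hsup⟩
  · filter_upwards [hB.continuous_paths] with ω hc
    exact ⟨fun ε hε => existsUnique_isRegSolution ha.le hε hc x₀ σ,
      fun t => tendsto_besselProcess ha.le hc t⟩
  · filter_upwards [hsup] with ω hω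
    exact limsup_div_rpow_eq_top (by positivity) hα hω
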